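/- Fix an integer $N\ge 2$. Let $\mathbb T$ be the unit circle with normalized Haar measure; functions on $\mathbb T$ are identified with $2\pi$-periodic functions through $z=e^{-i\theta}$. A *cycle* is a set $\{z_1,\dots,z_p\}\subset\mathbb T$ of $p\ge 1$ distinct points with $z_1^N=z_2,\ \dots,\ z_{p-1}^N=z_p,\ z_p^N=z_1$. A *wavelet representation* $(H,U,\pi)$ consists of a Hilbert space $H$, a unitary $U$ on $H$ and a (unital $*$-)representation $\pi$ of $L^\infty(\mathbb T)$ on $H$ with $U\pi(f)U^{-1}=\pi(f(z^N))$ for all $f$; put $T=\pi(z)$. For a cycle $C=\{z_1,\dots,z_p\}$, let $\mathfrak R_C$ be the wavelet representation on $L^2(\mathbb R)^p$ given by $$U_C(\xi_1,\dots,\xi_p)=(U_0\xi_2,\dots,U_0\xi_p,U_0\xi_1),\qquad \pi_C(f)(\xi_1,\dots,\xi_p)=\big(\pi_0(f(z_1z))\xi_1,\dots,\pi_0(f(z_pz))\xi_p\big),$$ where $U_0\xi(x)=N^{-1/2}\xi(x/N)$ and $\widehat{\pi_0(f)\xi}(\theta)=f(e^{-i\theta})\,\widehat\xi(\theta)$,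 with $\widehat\xi(\theta)=\int_{\mathbb R}\xi(x)e^{-i\theta x}\,dx$. A vector $\varphi\in H$ is an *orthogonal scaling vector with filter* $m_0\in L^\infty(\mathbb T)$ for $(H,U,\pi)$ if $U\varphi=\pi(m_0)\varphi$ and there are closed subspaces $(V_k)_{k\in\mathbb Z}$ of $H$ with $V_k\subset V_{k+1}$, $\overline{\bigcup_k V_k}=H$, $\bigcap_k V_k=\{0\}$, $U(V_k)=V_{k-1}$, and $\{T^k\varphi : k\in\mathbb Z\}$ an orthonormal basis of $V_0$. **Proposition.** Suppose $m_0=\sqrt N\,\chi_E$ (a.e.), where $E\subset[-\pi,\pi]$ is a union of intervals such that for no endpoint $t$ of these intervals does $e^{-it}$ lie on a cycle. Assume that for some distinct cycles $C_1,\dots,C_n$ the wavelet representation $\mathfrak R_{C_1}\oplus\dots\oplus\mathfrak R_{C_n}$ has an orthogonal scaling vector with filter $m_0$. Then every cycle $D$ disjoint from $C_1\cup\dots\cup C_n$ has a point in $[-\pi,\pi]\setminus E$, that is, there is $\theta\in[-\pi,\pi]\setminus E$ with $e^{-i\theta}\in D$. -/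

import Mathlib

open MeasureTheory Set
open scoped Real ENNReal FourierTransform

set_option linter.unusedSectionVars false

noncomputable section

namespace SuperWavelet

/-! ## The circle

The unit circle is modelled by `ℝ / 2πℤ` through the identification `z = e^{-iθ}`, and it carries
its normalized Haar measure. Under this identification the map `z ↦ z ^ N` is `θ ↦ N • θ`, and
multiplication by `z₀ = e^{-iθ₀}` is translation by `θ₀`. -/

instance fact_two_pi_pos : Fact (0 < 2 * π) := ⟨Real.two_pi_pos⟩

/-- The circle `𝕋`, parametrized by `θ mod 2π`; the class of `θ` stands for `z = e^{-iθ}`. -/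
abbrev Torus : Type := AddCircle (2 * π)

/-- The normalized Haar measure on the circle. -/
abbrev haarT : Measure Torus := AddCircle.haarAddCircle

/-- `L^∞(𝕋)`. The pointwise product of `f` and `g` is `f • g`. -/
abbrev LInfty : Type := Lp ℂ ∞ haarT

/-- `L²(ℝ)`. -/
abbrev L2R : Type := Lp ℂ 2 (volume : Measure ℝ)

/-- The identity function `z ↦ z` of the circle, i.e. `θ ↦ e^{-iθ}`, as an element of `L^∞`. -/
def idFn : LInfty := fourierLp ∞ (-1)

theorem measurePreserving_nsmul (N : ℕ) [NeZero N] :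
    MeasurePreserving (fun t : Torus => N • t) haarT haarT := by
  have h := Measure.measurePreserving_zsmul (G := Torus) haarT (n := (N : ℤ))
    (by exact_mod_cast NeZero.ne N)
  simpa using h

/-- `f(z ^ N)` for `f ∈ L^∞(𝕋)`. -/
def compPow (N : ℕ) [NeZero N] (f : LInfty) : LInfty :=
  Lp.compMeasurePreserving (fun t : Torus => N • t) (measurePreserving_nsmul N) f

/-- `f(z₀ z)` for `f ∈ L^∞(𝕋)`, where `z₀ = e^{-iθ₀}`. -/
def rotate (θ₀ : Torus) (f : LInfty) : LInfty :=
  Lp.compMeasurePreserving (fun t : Torus => θ₀ + t) (measurePreserving_add_left haarT θ₀) f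

theorem coeFn_compPow (N : ℕ) [NeZero N] (f : LInfty) :
    compPow N f =ᵐ[haarT] fun t => f (N • t) :=
  Lp.coeFn_compMeasurePreserving f (measurePreserving_nsmul N)

theorem coeFn_rotate (θ₀ : Torus) (f : LInfty) :
    rotate θ₀ f =ᵐ[haarT] fun t => f (θ₀ + t) :=
  Lp.coeFn_compMeasurePreserving f (measurePreserving_add_left haarT θ₀)

theorem quasi_add (θ₀ : Torus) :
    Measure.QuasiMeasurePreserving (fun t : Torus => θ₀ + t) haarT haarT :=
  (measurePreserving_add_left haarT θ₀).quasiMeasurePreserving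

theorem quasi_nsmul (N : ℕ) [NeZero N] :
    Measure.QuasiMeasurePreserving (fun t : Torus => N • t) haarT haarT :=
  (measurePreserving_nsmul N).quasiMeasurePreserving

theorem coeFn_mul (f g : LInfty) : (f • g : LInfty) =ᵐ[haarT] fun t => f t * g t :=
  Lp.coeFn_lpSMul f g

theorem rotate_add (θ₀ : Torus) (f g : LInfty) :
    rotate θ₀ (f + g) = rotate θ₀ f + rotate θ₀ g :=
  map_add _ f g

theorem rotate_smul (θ₀ : Torus) (c : ℂ) (f : LInfty) :
    rotate θ₀ (c • f) = c • rotate θ₀ f := by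
  apply Lp.ext
  filter_upwards [coeFn_rotate θ₀ (c • f), Lp.coeFn_smul c (rotate θ₀ f), coeFn_rotate θ₀ f,
    (quasi_add θ₀).ae (Lp.coeFn_smul c f)] with t h1 h2 h3 h4
  rw [h1, h2, h4, Pi.smul_apply, Pi.smul_apply, h3]

/-- `f ↦ f(z₀ z)` as a linear map. -/
def rotateLinear (θ₀ : Torus) : LInfty →ₗ[ℂ] LInfty where
  toFun := rotate θ₀
  map_add' := rotate_add θ₀
  map_smul' := rotate_smul θ₀

theorem rotate_one (θ₀ : Torus) :
    rotate θ₀ (Lp.const ∞ haarT (1 : ℂ)) = Lp.const ∞ haarT (1 : ℂ) := by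
  apply Lp.ext
  filter_upwards [coeFn_rotate θ₀ (Lp.const ∞ haarT (1 : ℂ)), Lp.coeFn_const ∞ haarT (1 : ℂ),
    (quasi_add θ₀).ae (Lp.coeFn_const ∞ haarT (1 : ℂ))] with t h1 h2 h3
  rw [h1, h2, h3]
  rfl

theorem rotate_mul (θ₀ : Torus) (f g : LInfty) :
    rotate θ₀ (f • g : LInfty) = (rotate θ₀ f • rotate θ₀ g : LInfty) := by
  apply Lp.ext
  filter_upwards [coeFn_rotate θ₀ (f • g : LInfty), coeFn_mul (rotate θ₀ f) (rotate θ₀ g),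
    coeFn_rotate θ₀ f, coeFn_rotate θ₀ g, (quasi_add θ₀).ae (coeFn_mul f g)] with t h1 h2 h3 h4 h5
  rw [h1, h2, h5, h3, h4]

theorem rotate_star (θ₀ : Torus) (f : LInfty) :
    rotate θ₀ (star f) = star (rotate θ₀ f) := by
  apply Lp.ext
  filter_upwards [coeFn_rotate θ₀ (star f), Lp.coeFn_star (rotate θ₀ f), coeFn_rotate θ₀ f,
    (quasi_add θ₀).ae (Lp.coeFn_star f)] with t h1 h2 h3 h4
  rw [h1, h2, h4, Pi.star_apply, Pi.star_apply, h3]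

theorem compPow_rotate (N : ℕ) [NeZero N] (θ₀ : Torus) (f : LInfty) :
    compPow N (rotate (N • θ₀) f) = rotate θ₀ (compPow N f) := by
  apply Lp.ext
  filter_upwards [coeFn_compPow N (rotate (N • θ₀) f), coeFn_rotate θ₀ (compPow N f),
    (quasi_nsmul N).ae (coeFn_rotate (N • θ₀) f), (quasi_add θ₀).ae (coeFn_compPow N f)]
    with t h1 h2 h3 h4
  rw [h1, h2, h3, h4, nsmul_add]

theorem star_idFn_mul : (star idFn • idFn : LInfty) = Lp.const ∞ haarT (1 : ℂ) := by
  apply Lp.ext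
  filter_upwards [coeFn_mul (star idFn) idFn, Lp.coeFn_star idFn, Lp.coeFn_const ∞ haarT (1 : ℂ),
    coeFn_fourierLp ∞ (T := 2 * π) (-1)] with t h1 h2 h3 h4
  rw [h1, h2, h3, Pi.star_apply, idFn, h4]
  simp [fourier_apply, ← Circle.coe_inv_eq_conj]

theorem idFn_mul_star : (idFn • star idFn : LInfty) = Lp.const ∞ haarT (1 : ℂ) := by
  rw [← star_idFn_mul]
  apply Lp.ext
  filter_upwards [coeFn_mul (star idFn) idFn, coeFn_mul idFn (star idFn)] with t h1 h2
  rw [h1, h2, mul_comm]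

/-! ## Wavelet representations -/

/-- A wavelet representation of scale `N` on the Hilbert space `H`: a unitary `U` (the dilation) and
a unital `*`-representation `rep` of `L^∞(𝕋)` on `H` such that `U rep(f) U⁻¹ = rep(f(z ^ N))`. -/
structure WaveletRep (N : ℕ) [N.AtLeastTwo] (H : Type*) [NormedAddCommGroup H]
    [InnerProductSpace ℂ H] [CompleteSpace H] where
  U : H ≃ₗᵢ[ℂ] H
  rep : LInfty →ₗ[ℂ] (H →L[ℂ] H)
  rep_one : ∀ ξ : H, rep (Lp.const ∞ haarT (1 : ℂ)) ξ = ξ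
  rep_mul : ∀ (f g : LInfty) (ξ : H), rep (f • g : LInfty) ξ = rep f (rep g ξ)
  rep_star : ∀ (f : LInfty) (ξ η : H), inner ℂ (rep f ξ) η = inner ℂ ξ (rep (star f) η)
  covariance : ∀ (f : LInfty) (ξ : H), U (rep f (U.symm ξ)) = rep (compPow N f) ξ

namespace WaveletRep

variable {N : ℕ} [N.AtLeastTwo] {H : Type*} [NormedAddCommGroup H] [InnerProductSpace ℂ H]
  [CompleteSpace H]

/-- The translation `T = rep(z)` of a wavelet representation, which is unitary. -/
def T (W : WaveletRep N H) : H ≃ₗᵢ[ℂ] H where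
  toFun := W.rep idFn
  invFun := W.rep (star idFn)
  map_add' := map_add _
  map_smul' := map_smul _
  left_inv ξ := by rw [← W.rep_mul, star_idFn_mul, W.rep_one]
  right_inv ξ := by rw [← W.rep_mul, idFn_mul_star, W.rep_one]
  norm_map' ξ := by
    have h : inner ℂ (W.rep idFn ξ) (W.rep idFn ξ) = inner ℂ ξ ξ := by
      rw [W.rep_star, ← W.rep_mul, star_idFn_mul, W.rep_one]
    change ‖W.rep idFn ξ‖ = ‖ξ‖
    rw [norm_eq_sqrt_re_inner (𝕜 := ℂ), norm_eq_sqrt_re_inner (𝕜 := ℂ) ξ, h]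

/-- `(V_n)` is a multiresolution analysis of the wavelet representation `W`, and the integer
translates of `φ` form an orthonormal basis of `V_0`. -/
structure IsMRA (W : WaveletRep N H) (V : ℤ → Submodule ℂ H) (φ : H) : Prop where
  isClosed : ∀ n, IsClosed (V n : Set H)
  subset_succ : ∀ n, V n ≤ V (n + 1)
  dense_iUnion : Dense (⋃ n, (V n : Set H))
  iInter_eq : ⋂ n, (V n : Set H) = {0}
  map_U : ∀ n, W.U '' (V n : Set H) = V (n - 1)
  mem_zero : φ ∈ V 0
  orthonormal : Orthonormal ℂ (fun k : ℤ => (W.T ^ k) φ)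
  span_eq : (Submodule.span ℂ (range fun k : ℤ => (W.T ^ k) φ)).topologicalClosure = V 0

/-- `φ` is an orthogonal scaling vector of `W`. -/
def IsOrthogonalScalingVector (W : WaveletRep N H) (φ : H) : Prop :=
  ∃ V : ℤ → Submodule ℂ H, W.IsMRA V φ

/-- `φ` is an orthogonal scaling vector of `W` with filter `m₀ ∈ L^∞(𝕋)`: besides being an
orthogonal scaling vector, it satisfies the scaling equation `U φ = rep(m₀) φ`. -/
def IsOrthogonalScalingVectorWithFilter (W : WaveletRep N H) (m₀ : LInfty) (φ : H) : Prop :=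
  W.IsOrthogonalScalingVector φ ∧ W.U φ = W.rep m₀ φ

end WaveletRep

/-! ## The classical representation on `L²(ℝ)` -/

theorem eLpNorm_comp_div {c : ℝ} (hc : 0 < c) {f : ℝ → ℂ} (hf : AEStronglyMeasurable f volume) :
    eLpNorm (fun x => ((√c)⁻¹ : ℂ) * f (x / c)) 2 volume = eLpNorm f 2 volume := by
  have hq : Measure.QuasiMeasurePreserving (fun x : ℝ => c⁻¹ * x) volume volume :=
    ⟨by fun_prop, by
      rw [Real.map_volume_mul_left (inv_ne_zero hc.ne')]
      exact Measure.smul_absolutelyContinuous⟩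
  have h1 : eLpNorm (fun x => f (x / c)) 2 volume
      = (ENNReal.ofReal c) ^ ((1 : ℝ) / 2) * eLpNorm f 2 volume := by
    have h2 : (fun x => f (x / c)) = f ∘ (fun x => c⁻¹ * x) := by
      funext x; simp [div_eq_inv_mul]
    rw [h2, ← eLpNorm_map_measure (hf.mono_ac hq.absolutelyContinuous) (by fun_prop),
      Real.map_volume_mul_left (inv_ne_zero hc.ne'), inv_inv, abs_of_pos hc,
      eLpNorm_smul_measure_of_ne_top (by norm_num)]
    simp
  have h3 : (fun x => ((√c)⁻¹ : ℂ) * f (x / c)) = ((√c)⁻¹ : ℂ) • (fun x => f (x / c)) := by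
    funext x; simp
  have hs : 0 < √c := Real.sqrt_pos.2 hc
  have h4 : ‖((√c)⁻¹ : ℂ)‖ₑ = ENNReal.ofReal ((√c)⁻¹) := by
    rw [← ofReal_norm, norm_inv, Complex.norm_real, Real.norm_of_nonneg hs.le]
  rw [h3, eLpNorm_const_smul, h1, h4, ENNReal.ofReal_rpow_of_pos hc, ← Real.sqrt_eq_rpow,
    ← mul_assoc, ← ENNReal.ofReal_mul (inv_nonneg.2 hs.le), inv_mul_cancel₀ hs.ne']
  simp

theorem quasi_div {c : ℝ} (hc : 0 < c) :
    Measure.QuasiMeasurePreserving (fun x : ℝ => x / c) volume volume := by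
  have h2 : (fun x : ℝ => x / c) = (fun x => c⁻¹ * x) := by
    funext x; simp [div_eq_inv_mul]
  rw [h2]
  exact ⟨by fun_prop, by
      rw [Real.map_volume_mul_left (inv_ne_zero hc.ne')]
      exact Measure.smul_absolutelyContinuous⟩

theorem memLp_dilate {c : ℝ} (hc : 0 < c) (f : L2R) :
    MemLp (fun x => ((√c)⁻¹ : ℂ) * f (x / c)) 2 volume := by
  refine ⟨?_, ?_⟩
  · exact ((Lp.aestronglyMeasurable f).comp_quasiMeasurePreserving (quasi_div hc)).const_mul _
  · rw [eLpNorm_comp_div hc (Lp.aestronglyMeasurable f)]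
    exact Lp.eLpNorm_lt_top f

/-- The dilation `f ↦ c^{-1/2} f(x / c)` of `L²(ℝ)`, as an isometry. -/
def dilateIsometry (c : ℝ) (hc : 0 < c) : L2R →ₗᵢ[ℂ] L2R where
  toFun f := (memLp_dilate hc f).toLp
  map_add' f g := by
    rw [← MemLp.toLp_add]
    apply MemLp.toLp_congr
    filter_upwards [(quasi_div hc).ae (Lp.coeFn_add f g)] with x hx
    rw [hx]
    exact mul_add _ _ _
  map_smul' a f := by
    rw [RingHom.id_apply, ← MemLp.toLp_const_smul]
    apply MemLp.toLp_congr
    filter_upwards [(quasi_div hc).ae (Lp.coeFn_smul a f)] with x hx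
    rw [hx]
    simp only [Pi.smul_apply, smul_eq_mul]
    ring
  norm_map' f := by
    simp only [LinearMap.coe_mk, AddHom.coe_mk]
    rw [Lp.norm_toLp, eLpNorm_comp_div hc (Lp.aestronglyMeasurable f), Lp.norm_def]

theorem coeFn_dilateIsometry {c : ℝ} (hc : 0 < c) (f : L2R) :
    dilateIsometry c hc f =ᵐ[volume] fun x => ((√c)⁻¹ : ℂ) * f (x / c) :=
  MemLp.coeFn_toLp (memLp_dilate hc f)

theorem dilateIsometry_comp {c d : ℝ} (hc : 0 < c) (hd : 0 < d) (h : c * d = 1) (f : L2R) :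
    dilateIsometry c hc (dilateIsometry d hd f) = f := by
  apply Lp.ext
  filter_upwards [coeFn_dilateIsometry hc (dilateIsometry d hd f),
    (quasi_div hc).ae (coeFn_dilateIsometry hd f)] with x h1 h2
  rw [h1, h2, div_div, h, div_one, ← mul_assoc, ← mul_inv, ← Complex.ofReal_mul,
    ← Real.sqrt_mul hc.le, h]
  simp

/-- The unitary dilation `f ↦ c^{-1/2} f(x / c)` of `L²(ℝ)`. -/
def dilate (c : ℝ) (hc : 0 < c) : L2R ≃ₗᵢ[ℂ] L2R :=
  { dilateIsometry c hc with
    invFun := dilateIsometry c⁻¹ (inv_pos.2 hc)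
    left_inv := fun f => dilateIsometry_comp _ _ (inv_mul_cancel₀ hc.ne') f
    right_inv := fun f => dilateIsometry_comp _ _ (mul_inv_cancel₀ hc.ne') f }

theorem coeFn_dilate {c : ℝ} (hc : 0 < c) (f : L2R) :
    dilate c hc f =ᵐ[volume] fun x => ((√c)⁻¹ : ℂ) * f (x / c) :=
  coeFn_dilateIsometry hc f

theorem coeFn_dilate_symm {c : ℝ} (hc : 0 < c) (f : L2R) :
    (dilate c hc).symm f =ᵐ[volume] fun x => ((√c) : ℂ) * f (c * x) := by
  filter_upwards [coeFn_dilateIsometry (inv_pos.2 hc) f] with x hx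
  change dilateIsometry c⁻¹ (inv_pos.2 hc) f x = _
  rw [hx]
  simp [mul_comm]

/-- The Fourier transform turns the dilation into its inverse. -/
theorem fourier_dilate {c : ℝ} (hc : 0 < c) (f : L2R) :
    𝓕 (dilate c hc f) = (dilate c hc).symm (𝓕 f) := by
  let F := Lp.fourierTransformₗᵢ ℝ ℂ
  change F (dilate c hc f) = (dilate c hc).symm (F f)
  refine DenseRange.induction_on
    (p := fun f : L2R => F (dilate c hc f) = (dilate c hc).symm (F f))
    (SchwartzMap.denseRange_toLpCLM (E := ℝ) (F := ℂ) (p := 2) (μ := volume)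
      ENNReal.ofNat_ne_top) f ?_ ?_
  · apply isClosed_eq <;> fun_prop
  intro g
  let e : ℝ ≃L[ℝ] ℝ := ContinuousLinearEquiv.smulLeft (Units.mk0 c⁻¹ (inv_ne_zero hc.ne'))
  let g' : SchwartzMap ℝ ℂ :=
    ((√c)⁻¹ : ℂ) • SchwartzMap.compCLMOfContinuousLinearEquiv ℂ e g
  have he : ∀ x, e x = x / c := fun x => by
    simp [e, div_eq_inv_mul, Units.smul_def]
  have hg' : ∀ x, g' x = ((√c)⁻¹ : ℂ) * g (x / c) := fun x => by
    simp [g', he]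
  have h1 : dilate c hc (g.toLp 2) = g'.toLp 2 := by
    apply Lp.ext
    filter_upwards [coeFn_dilate hc (g.toLp 2), g'.coeFn_toLp 2 volume,
      (quasi_div hc).ae (g.coeFn_toLp 2 volume)] with x h1 h2 h3
    rw [h1, h2, hg', h3]
  have h2 : F (dilate c hc (g.toLp 2)) = (𝓕 g').toLp 2 := by
    rw [h1]; exact SchwartzMap.toLp_fourier_eq g'
  have h3 : F (g.toLp 2) = (𝓕 g).toLp 2 := SchwartzMap.toLp_fourier_eq g
  change F (dilate c hc (g.toLp 2)) = (dilate c hc).symm (F (g.toLp 2))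
  rw [h2, h3]
  have hq : Measure.QuasiMeasurePreserving (fun x : ℝ => c * x) volume volume := by
    simpa [div_eq_mul_inv, mul_comm] using quasi_div (inv_pos.2 hc)
  apply Lp.ext
  filter_upwards [coeFn_dilate_symm hc ((𝓕 g).toLp 2), (𝓕 g').coeFn_toLp 2 volume,
    hq.ae ((𝓕 g).coeFn_toLp 2 volume)] with x h4 h5 h6
  rw [h4, h5, h6, SchwartzMap.fourier_coe, SchwartzMap.fourier_coe, Real.fourier_eq,
    Real.fourier_eq]
  have hs : 0 < √c := Real.sqrt_pos.2 hc
  have h7 := Measure.integral_comp_mul_left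
    (fun v : ℝ => (𝐞 (-inner ℝ v (c * x)) : Circle) • g v) c⁻¹
  have h8 : (fun v : ℝ => (𝐞 (-inner ℝ v x) : Circle) • g' v)
      = fun v => ((√c)⁻¹ : ℂ) • ((𝐞 (-inner ℝ (c⁻¹ * v) (c * x)) : Circle) • g (c⁻¹ * v)) := by
    funext v
    have : (inner ℝ (c⁻¹ * v) (c * x) : ℝ) = inner ℝ v x := by
      simp; field_simp
    rw [this, hg', smul_comm, div_eq_inv_mul, smul_eq_mul]
  rw [h8, integral_smul, h7, inv_inv, abs_of_pos hc]
  have h9 : (c : ℂ) = (√c : ℂ) * (√c : ℂ) := by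
    rw [← Complex.ofReal_mul, Real.mul_self_sqrt hc.le]
  have hs' : (√c : ℂ) ≠ 0 := by exact_mod_cast hs.ne'
  rw [Complex.real_smul, smul_eq_mul, ← mul_assoc]
  congr 1
  rw [h9]
  field_simp

/-- The map `x ↦ e^{-2πix}` from the line to the circle. -/
def wrap (x : ℝ) : Torus := ((2 * π * x : ℝ) : Torus)

theorem quasi_wrap : Measure.QuasiMeasurePreserving wrap volume haarT := by
  have hmk : Measure.QuasiMeasurePreserving (fun x : ℝ => (x : Torus)) volume haarT := by
    have hm : Measurable (fun x : ℝ => (x : Torus)) := (AddCircle.continuous_mk' _).measurable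
    refine ⟨hm, ?_⟩
    refine Measure.AbsolutelyContinuous.mk fun s hs h0 => ?_
    rw [Measure.map_apply hm hs]
    have hv : (volume : Measure Torus) s = 0 := by
      rw [AddCircle.volume_eq_smul_haarAddCircle, Measure.smul_apply, h0, smul_zero]
    have hpiece : ∀ n : ℤ, volume ((fun x : ℝ => (x : Torus)) ⁻¹' s ∩
        Ioc (0 + n • (2 * π)) (0 + (n + 1) • (2 * π))) = 0 := fun n => by
      have h := (AddCircle.measurePreserving_mk (2 * π) (0 + n • (2 * π))).measure_preimage
        hs.nullMeasurableSet
      rw [hv, Measure.restrict_apply (hm hs)] at h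
      have he : 0 + (n + 1) • (2 * π) = 0 + n • (2 * π) + 2 * π := by
        rw [add_smul, one_smul]; ring
      rw [he]
      exact h
    have hU := iUnion_Ioc_add_zsmul Real.two_pi_pos (0 : ℝ)
    rw [← inter_univ ((fun x : ℝ => (x : Torus)) ⁻¹' s), ← hU, inter_iUnion]
    exact measure_iUnion_null hpiece
  refine hmk.comp (g := fun x : ℝ => (x : Torus)) (f := fun x : ℝ => 2 * π * x) ⟨by fun_prop, ?_⟩
  rw [Real.map_volume_mul_left Real.two_pi_pos.ne']
  exact Measure.smul_absolutelyContinuous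

theorem memLp_wrap (f : LInfty) : MemLp (fun x => f (wrap x)) ∞ volume := by
  refine ⟨(Lp.aestronglyMeasurable f).comp_quasiMeasurePreserving quasi_wrap, ?_⟩
  refine lt_of_le_of_lt ?_ (Lp.eLpNorm_lt_top f)
  rw [eLpNorm_exponent_top, eLpNorm_exponent_top]
  refine essSup_le_of_ae_le _ ?_
  exact quasi_wrap.ae (enorm_ae_le_eLpNormEssSup f haarT)

/-- The function `x ↦ f(e^{-2πix})` in `L^∞(ℝ)`, for `f ∈ L^∞(𝕋)`. -/
def pullback : LInfty →ₗ[ℂ] Lp ℂ ∞ (volume : Measure ℝ) where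
  toFun f := (memLp_wrap f).toLp
  map_add' f g := by
    rw [← MemLp.toLp_add]
    apply MemLp.toLp_congr
    filter_upwards [quasi_wrap.ae (Lp.coeFn_add f g)] with x hx
    rw [hx]
    rfl
  map_smul' c f := by
    rw [RingHom.id_apply, ← MemLp.toLp_const_smul]
    apply MemLp.toLp_congr
    filter_upwards [quasi_wrap.ae (Lp.coeFn_smul c f)] with x hx
    rw [hx]
    rfl

theorem coeFn_pullback (f : LInfty) : pullback f =ᵐ[volume] fun x => f (wrap x) :=
  MemLp.coeFn_toLp (memLp_wrap f)

/-- Multiplication of an `L²(ℝ)` function by `x ↦ f(e^{-2πix})`. -/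
def multiplier : LInfty →ₗ[ℂ] (L2R →L[ℂ] L2R) :=
  ((ContinuousLinearMap.mul ℂ ℂ).holderL volume ∞ 2 2).toLinearMap.comp pullback

theorem coeFn_multiplier (f : LInfty) (ξ : L2R) :
    multiplier f ξ =ᵐ[volume] fun x => f (wrap x) * ξ x := by
  filter_upwards [(ContinuousLinearMap.mul ℂ ℂ).coeFn_holder (r := 2) (pullback f) ξ,
    coeFn_pullback f] with x h1 h2
  change (ContinuousLinearMap.mul ℂ ℂ).holder 2 (pullback f) ξ x = _
  rw [h1, h2]
  rfl

/-- The Fourier transform of `L²(ℝ)`, in the normalization `f̂(x) = ∫ f(t) e^{-2πixt} dt`. -/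
abbrev fourierL2 : L2R ≃ₗᵢ[ℂ] L2R := Lp.fourierTransformₗᵢ ℝ ℂ

/-- The representation of `L^∞(𝕋)` on `L²(ℝ)` given on the Fourier side by multiplication by the
`2π`-periodic function `θ ↦ f(e^{-iθ})`. As the Fourier variable is normalized here as `x = θ / 2π`,
the multiplier is `x ↦ f(e^{-2πix})`. In particular `z` acts as `ξ ↦ ξ(· - 1)`. -/
def classicalRep : LInfty →ₗ[ℂ] (L2R →L[ℂ] L2R) where
  toFun f := (fourierL2.symm.toContinuousLinearEquiv : L2R →L[ℂ] L2R).comp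
    ((multiplier f).comp (fourierL2.toContinuousLinearEquiv : L2R →L[ℂ] L2R))
  map_add' f g := by ext1 ξ; simp
  map_smul' c f := by ext1 ξ; simp

theorem classicalRep_apply (f : LInfty) (ξ : L2R) :
    classicalRep f ξ = fourierL2.symm (multiplier f (fourierL2 ξ)) := rfl

theorem multiplier_one (ξ : L2R) : multiplier (Lp.const ∞ haarT (1 : ℂ)) ξ = ξ := by
  apply Lp.ext
  filter_upwards [coeFn_multiplier (Lp.const ∞ haarT (1 : ℂ)) ξ,
    quasi_wrap.ae (Lp.coeFn_const ∞ haarT (1 : ℂ))] with x h1 h2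
  rw [h1, h2]
  exact one_mul _

theorem multiplier_mul (f g : LInfty) (ξ : L2R) :
    multiplier (f • g : LInfty) ξ = multiplier f (multiplier g ξ) := by
  apply Lp.ext
  filter_upwards [coeFn_multiplier (f • g : LInfty) ξ, coeFn_multiplier f (multiplier g ξ),
    coeFn_multiplier g ξ, quasi_wrap.ae (coeFn_mul f g)] with x h1 h2 h3 h4
  rw [h1, h2, h3, h4, mul_assoc]

theorem multiplier_star (f : LInfty) (ξ η : L2R) :
    inner ℂ (multiplier f ξ) η = inner ℂ ξ (multiplier (star f) η) := by
  rw [L2.inner_def, L2.inner_def]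
  apply integral_congr_ae
  filter_upwards [coeFn_multiplier f ξ, coeFn_multiplier (star f) η,
    quasi_wrap.ae (Lp.coeFn_star f)] with x h1 h2 h3
  rw [h1, h2, h3]
  simp only [RCLike.inner_apply, map_mul, Pi.star_apply, RCLike.star_def]
  ring

theorem multiplier_compPow (N : ℕ) [N.AtLeastTwo] (hN : (0 : ℝ) < N) (f : LInfty) (ξ : L2R) :
    (dilate N hN).symm (multiplier f (dilate N hN ξ)) = multiplier (compPow N f) ξ := by
  have hq : Measure.QuasiMeasurePreserving (fun x : ℝ => (N : ℝ) * x) volume volume := by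
    simpa [div_eq_mul_inv, mul_comm] using quasi_div (inv_pos.2 hN)
  apply Lp.ext
  filter_upwards [coeFn_dilate_symm hN (multiplier f (dilate N hN ξ)),
    hq.ae (coeFn_multiplier f (dilate N hN ξ)), hq.ae (coeFn_dilate hN ξ),
    coeFn_multiplier (compPow N f) ξ, quasi_wrap.ae (coeFn_compPow N f)] with x h1 h2 h3 h4 h5
  have hw : N • wrap x = wrap ((N : ℝ) * x) := by
    unfold wrap
    rw [← AddCircle.coe_nsmul]
    congr 1
    rw [nsmul_eq_mul]; ring
  have hs : (√(N : ℝ) : ℂ) ≠ 0 := by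
    exact_mod_cast (Real.sqrt_pos.2 hN).ne'
  rw [h1, h2, h3, h4, h5, hw, mul_div_cancel_left₀ _ hN.ne']
  field_simp

theorem natCast_pos' (N : ℕ) [N.AtLeastTwo] : (0 : ℝ) < N :=
  Nat.cast_pos.2 (NeZero.pos N)

/-- The classical wavelet representation `ℜ₀` on `L²(ℝ)`: `U ξ(x) = N^{-1/2} ξ(x / N)`, and `f` acts
on the Fourier side as multiplication by `θ ↦ f(e^{-iθ})`. -/
def classical (N : ℕ) [N.AtLeastTwo] : WaveletRep N L2R where
  U := dilate N (natCast_pos' N)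
  rep := classicalRep
  rep_one ξ := by rw [classicalRep_apply, multiplier_one, LinearIsometryEquiv.symm_apply_apply]
  rep_mul f g ξ := by
    rw [classicalRep_apply, classicalRep_apply, classicalRep_apply, multiplier_mul,
      LinearIsometryEquiv.apply_symm_apply]
  rep_star f ξ η := by
    rw [classicalRep_apply, classicalRep_apply, ← fourierL2.inner_map_map,
      LinearIsometryEquiv.apply_symm_apply, multiplier_star, ← fourierL2.inner_map_map ξ,
      LinearIsometryEquiv.apply_symm_apply]
  covariance f ξ := by
    have key : ∀ η : L2R, fourierL2 (dilate N (natCast_pos' N) η)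
        = (dilate N (natCast_pos' N)).symm (fourierL2 η) := fourier_dilate (natCast_pos' N)
    have key' : fourierL2 ((dilate N (natCast_pos' N)).symm ξ)
        = dilate N (natCast_pos' N) (fourierL2 ξ) := by
      have h := key ((dilate N (natCast_pos' N)).symm ξ)
      rw [LinearIsometryEquiv.apply_symm_apply] at h
      rw [h, LinearIsometryEquiv.apply_symm_apply]
    apply fourierL2.injective
    rw [key, classicalRep_apply, classicalRep_apply, LinearIsometryEquiv.apply_symm_apply,
      LinearIsometryEquiv.apply_symm_apply, key', multiplier_compPow]

/-! ## Direct sums and cyclic amplifications -/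

section Sums

variable {ι : Type*} [Fintype ι] {H : ι → Type*} [∀ i, NormedAddCommGroup (H i)]
  [∀ i, InnerProductSpace ℂ (H i)]

/-- The operator `⊕ᵢ Aᵢ` on the Hilbert space direct sum `⊕ᵢ Hᵢ`. -/
def diagOp (A : ∀ i, H i →L[ℂ] H i) : PiLp 2 H →L[ℂ] PiLp 2 H :=
  ((PiLp.continuousLinearEquiv 2 ℂ H).symm : (∀ i, H i) →L[ℂ] PiLp 2 H).comp
    (ContinuousLinearMap.pi fun i => (A i).comp (PiLp.proj 2 H i))

theorem diagOp_apply (A : ∀ i, H i →L[ℂ] H i) (ξ : PiLp 2 H) (i : ι) :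
    diagOp A ξ i = A i (ξ i) := rfl

/-- The direct sum of finitely many representations `ρᵢ` of `L^∞(𝕋)`. -/
def diagRep (ρ : ∀ i, LInfty →ₗ[ℂ] (H i →L[ℂ] H i)) :
    LInfty →ₗ[ℂ] (PiLp 2 H →L[ℂ] PiLp 2 H) where
  toFun f := diagOp fun i => ρ i f
  map_add' f g := by
    ext ξ i
    simp [diagOp_apply]
  map_smul' c f := by
    ext ξ i
    simp [diagOp_apply]

theorem diagRep_apply (ρ : ∀ i, LInfty →ₗ[ℂ] (H i →L[ℂ] H i)) (f : LInfty) (ξ : PiLp 2 H)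
    (i : ι) : diagRep ρ f ξ i = ρ i f (ξ i) := rfl

/-- The direct sum of finitely many wavelet representations. -/
def directSum {N : ℕ} [N.AtLeastTwo] [∀ i, CompleteSpace (H i)] (W : ∀ i, WaveletRep N (H i)) :
    WaveletRep N (PiLp 2 H) where
  U := LinearIsometryEquiv.piLpCongrRight 2 fun i => (W i).U
  rep := diagRep fun i => (W i).rep
  rep_one ξ := by
    ext i
    rw [diagRep_apply, (W i).rep_one]
  rep_mul f g ξ := by
    ext i
    rw [diagRep_apply, diagRep_apply, diagRep_apply, (W i).rep_mul]
  rep_star f ξ η := by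
    rw [PiLp.inner_apply, PiLp.inner_apply]
    refine Finset.sum_congr rfl fun i _ => ?_
    rw [diagRep_apply, diagRep_apply, (W i).rep_star]
  covariance f ξ := by
    ext i
    exact (W i).covariance f (ξ i)

end Sums

/-- A cycle of length `p ≥ 1` for the map `z ↦ z ^ N` of the circle, listed as distinct points
`z_1, …, z_p` with `z_1 ^ N = z_2, …, z_p ^ N = z_1`. The points are given through their angles,
and `finRotate p` is the cyclic successor `k ↦ k + 1` on `{0, …, p - 1}`. -/
structure CircleCycle (N : ℕ) where
  length : ℕ
  length_pos : 0 < length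
  pt : Fin length → Torus
  injective : Function.Injective pt
  next : ∀ k, N • pt k = pt (finRotate length k)

/-- The set of points of a cycle. -/
def CircleCycle.points {N : ℕ} (C : CircleCycle N) : Set Torus := range C.pt

section Amplification

variable {N : ℕ} [N.AtLeastTwo] {H : Type*} [NormedAddCommGroup H] [InnerProductSpace ℂ H]
  [CompleteSpace H]

/-- The unitary `(ξ_1, …, ξ_p) ↦ (U ξ_2, …, U ξ_p, U ξ_1)` of `H ⊕ ⋯ ⊕ H` (`p` times). -/
def cyclicDilation (U : H ≃ₗᵢ[ℂ] H) (p : ℕ) :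
    (PiLp 2 fun _ : Fin p => H) ≃ₗᵢ[ℂ] (PiLp 2 fun _ : Fin p => H) :=
  (LinearIsometryEquiv.piLpCongrLeft 2 ℂ H (finRotate p).symm).trans
    (LinearIsometryEquiv.piLpCongrRight 2 fun _ => U)

theorem cyclicDilation_apply (U : H ≃ₗᵢ[ℂ] H) (p : ℕ) (ξ : PiLp 2 fun _ : Fin p => H)
    (k : Fin p) : cyclicDilation U p ξ k = U (ξ (finRotate p k)) := by
  simp [cyclicDilation, LinearIsometryEquiv.piLpCongrLeft_apply, Equiv.piCongrLeft'_apply]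

/-- The cyclic amplification of the wavelet representation `W` with the cycle `C = {z_1, …, z_p}`
(and modulation `1`), on `H ⊕ ⋯ ⊕ H` (`p` times):
`U_C (ξ_1, …, ξ_p) = (U ξ_2, …, U ξ_p, U ξ_1)` and
`π_C(f) (ξ_1, …, ξ_p) = (π(f(z_1 z)) ξ_1, …, π(f(z_p z)) ξ_p)`. -/
def cyclicAmplification (W : WaveletRep N H) (C : CircleCycle N) :
    WaveletRep N (PiLp 2 fun _ : Fin C.length => H) where
  U := cyclicDilation W.U C.length
  rep := diagRep fun k => W.rep.comp (rotateLinear (C.pt k))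
  rep_one ξ := by
    ext k
    change W.rep (rotate (C.pt k) _) (ξ k) = ξ k
    rw [rotate_one, W.rep_one]
  rep_mul f g ξ := by
    ext k
    change W.rep (rotate (C.pt k) _) (ξ k)
      = W.rep (rotate (C.pt k) f) (W.rep (rotate (C.pt k) g) (ξ k))
    rw [rotate_mul, W.rep_mul]
  rep_star f ξ η := by
    rw [PiLp.inner_apply, PiLp.inner_apply]
    refine Finset.sum_congr rfl fun k _ => ?_
    change inner ℂ (W.rep (rotate (C.pt k) f) (ξ k)) (η k)
      = inner ℂ (ξ k) (W.rep (rotate (C.pt k) (star f)) (η k))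
    rw [rotate_star, W.rep_star]
  covariance f ξ := by
    obtain ⟨η, rfl⟩ := (cyclicDilation W.U C.length).surjective ξ
    rw [LinearIsometryEquiv.symm_apply_apply]
    ext k
    rw [cyclicDilation_apply]
    change W.U (W.rep (rotate (C.pt (finRotate C.length k)) f) (η (finRotate C.length k)))
      = W.rep (rotate (C.pt k) (compPow N f)) (cyclicDilation W.U C.length η k)
    rw [cyclicDilation_apply, ← compPow_rotate, ← W.covariance,
      LinearIsometryEquiv.symm_apply_apply, C.next]

end Amplification

/-- The wavelet representation `ℜ_{C_1} ⊕ ⋯ ⊕ ℜ_{C_n}`, where `ℜ_C` is the cyclic amplification of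
the classical representation with the cycle `C`. -/
def cycleRep {N : ℕ} [N.AtLeastTwo] {n : ℕ} (C : Fin n → CircleCycle N) :
    WaveletRep N (PiLp 2 fun i : Fin n => PiLp 2 fun _ : Fin (C i).length => L2R) :=
  directSum fun i => cyclicAmplification (classical N) (C i)

/-- `I` is a bounded interval of the line (open, closed or half-open) with endpoints `a ≤ b`. -/
def IsIntervalWithEndpoints (I : Set ℝ) (a b : ℝ) : Prop :=
  a ≤ b ∧ Ioo a b ⊆ I ∧ I ⊆ Icc a b

end SuperWavelet

end

open SuperWavelet

/-! Only the orthonormality of the translates `T ^ k φ` and the scaling equation are needed.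

Write `z_k` for the points of the cycles `C_i` and `f_k` for the Fourier transforms of the
components of `φ`. Orthonormality says that the spectral measure `B ↦ ‖π(χ_B) φ‖²`, obtained by
wrapping each `|f_k|²` around the circle and translating it by `z_k`, has the Fourier coefficients of
the Haar measure, and so equals it (`spectralMeasure_eq_haarT`).

Suppose that all angles of `D` belong to `E`. They are not endpoints of the intervals, so `m₀ = √N`
almost everywhere within some distance `r` of `D` (`exists_forall_ae_eq_sqrt`). Fix a point `w` of
`D` and let `B_J` be the arc of radius `r / N ^ J` around `w`. For `j ≤ J`, the map `z ↦ z ^ (N ^ j)`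
sends `B_J` to within `r` of `D`; iterating the scaling equation therefore gives
`π(χ_{B_J}) U ^ J φ = √N ^ J π(χ_{B_J}) φ` (`rep_indicatorT_U_iterate`). Hence the spectral measure
of `U ^ J φ` gives `B_J` the mass `N ^ J · |B_J| = r / π`, independently of `J`.

On the other hand, `w` has positive distance from all the `z_k`, so this mass can only come from the
part of the Fourier transforms of the components of `U ^ J φ` outside a fixed neighbourhood of `0`.
As `U` contracts Fourier transforms by the factor `N`, this part is the energy of the `f_k` outside
a neighbourhood of radius proportional to `N ^ J` (`fourierTail_U_iterate`), which tends to `0`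
(`tendsto_fourierTail`). This is a contradiction. -/

noncomputable section

namespace SuperWavelet

open Filter Topology

/-! ### Finite measures on the circle -/

theorem continuous_integral_continuousMap {X : Type*} [TopologicalSpace X] [CompactSpace X]
    [MeasurableSpace X] [BorelSpace X] (μ : Measure X) [IsFiniteMeasure μ] :
    Continuous fun f : C(X, ℂ) => ∫ x, f x ∂μ := by
  have h : (fun f : C(X, ℂ) => ∫ x, f x ∂μ)
      = fun f => ∫ x, ContinuousMap.toLp 1 μ ℂ f x ∂μ := by
    funext f
    exact integral_congr_ae (ContinuousMap.coeFn_toLp (𝕜 := ℂ) (p := 1) μ f).symm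
  rw [h]
  exact continuous_integral.comp (ContinuousMap.toLp 1 μ ℂ).continuous

/-- A finite measure on the circle is determined by its Fourier coefficients. -/
theorem measure_ext_of_integral_fourier {T : ℝ} [Fact (0 < T)] {μ ν : Measure (AddCircle T)}
    [IsFiniteMeasure μ] [IsFiniteMeasure ν]
    (h : ∀ n : ℤ, ∫ t, fourier n t ∂μ = ∫ t, fourier n t ∂ν) : μ = ν := by
  have hint : ∀ (ρ : Measure (AddCircle T)) [IsFiniteMeasure ρ] (f : C(AddCircle T, ℂ)),
      Integrable f ρ := fun ρ _ f =>
    f.continuous.integrable_of_hasCompactSupport (HasCompactSupport.of_compactSpace _)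
  let S : Submodule ℂ C(AddCircle T, ℂ) :=
    { carrier := {f | ∫ t, f t ∂μ = ∫ t, f t ∂ν}
      add_mem' := fun {f g} hf hg => by
        simp only [mem_ofPred_eq, ContinuousMap.add_apply] at *
        rw [integral_add (hint μ f) (hint μ g), integral_add (hint ν f) (hint ν g), hf, hg]
      zero_mem' := by simp
      smul_mem' := fun c f hf => by
        simp only [mem_ofPred_eq, ContinuousMap.smul_apply] at *
        rw [integral_smul, integral_smul, hf] }
  have hS : IsClosed (S : Set C(AddCircle T, ℂ)) :=
    isClosed_eq (continuous_integral_continuousMap μ) (continuous_integral_continuousMap ν)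
  have htop : ∀ f : C(AddCircle T, ℂ), f ∈ S := fun f => by
    have hle : (Submodule.span ℂ (range (@fourier T))).topologicalClosure ≤ S :=
      Submodule.topologicalClosure_minimal _
        (Submodule.span_le.2 (by rintro _ ⟨n, rfl⟩; exact h n)) hS
    rw [span_fourier_closure_eq_top] at hle
    exact hle trivial
  refine ext_of_forall_integral_eq_of_IsFiniteMeasure fun f => ?_
  have hf := htop ⟨fun t => (f t : ℂ), Complex.continuous_ofReal.comp f.continuous⟩
  simp only [S, Submodule.mem_mk, AddSubmonoid.mem_mk, AddSubsemigroup.mem_mk, mem_ofPred_eq,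
    ContinuousMap.coe_mk] at hf
  have h1 : ((∫ t, f t ∂μ : ℝ) : ℂ) = ((∫ t, f t ∂ν : ℝ) : ℂ) := by
    rw [← integral_complex_ofReal, ← integral_complex_ofReal]
    exact hf
  exact_mod_cast h1

theorem haarT_closedBall (t : Torus) {r : ℝ} (hr : r ≤ π) :
    haarT (Metric.closedBall t r) = ENNReal.ofReal (r / π) := by
  have h : ENNReal.ofReal (2 * π) * haarT (Metric.closedBall t r) = ENNReal.ofReal (2 * r) := by
    have h1 := AddCircle.volume_closedBall (2 * π) (x := t) r
    rwa [AddCircle.volume_eq_smul_haarAddCircle, Measure.smul_apply, smul_eq_mul,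
      min_eq_right (by linarith)] at h1
  have hpos : ENNReal.ofReal (2 * π) ≠ 0 := by simpa using Real.pi_pos
  rw [← ENNReal.mul_right_inj hpos ENNReal.ofReal_ne_top, h,
    ← ENNReal.ofReal_mul Real.two_pi_pos.le]
  congr 1
  field_simp

theorem norm_wrap_le (x : ℝ) : ‖wrap x‖ ≤ 2 * π * |x| := by
  have h : ‖wrap x‖ ≤ ‖2 * π * x‖ := QuotientAddGroup.norm_mk_le_norm
  rwa [norm_mul, Real.norm_of_nonneg Real.two_pi_pos.le] at h

theorem measurable_wrap : Measurable wrap := quasi_wrap.measurable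

theorem enorm_sq_eq_lintegral (F : L2R) : ‖F‖ₑ ^ 2 = ∫⁻ x, ‖F x‖ₑ ^ 2 := by
  have h := eLpNorm_nnreal_pow_eq_lintegral (f := F) (μ := volume) (p := 2) (by norm_num)
  rw [Lp.enorm_def]
  norm_num at h
  exact h

theorem PiLp_enorm_sq {ι : Type*} [Fintype ι] {H : ι → Type*} [∀ i, NormedAddCommGroup (H i)]
    (ξ : PiLp 2 H) : ‖ξ‖ₑ ^ 2 = ∑ i, ‖ξ i‖ₑ ^ 2 := by
  have h := PiLp.norm_sq_eq_of_L2 H ξ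
  simp only [← ofReal_norm, ← ENNReal.ofReal_pow (norm_nonneg _)]
  rw [h, ENNReal.ofReal_sum_of_nonneg fun _ _ => by positivity]

/-! ### Operators of a wavelet representation -/

section WaveletRep

variable {N : ℕ} [N.AtLeastTwo] {H : Type*} [NormedAddCommGroup H] [InnerProductSpace ℂ H]
  [CompleteSpace H] (W : WaveletRep N H)

theorem fourierLp_zero_eq_const : fourierLp (T := 2 * π) ∞ 0 = Lp.const ∞ haarT (1 : ℂ) := by
  apply Lp.ext
  filter_upwards [coeFn_fourierLp (T := 2 * π) ∞ 0, Lp.coeFn_const ∞ haarT (1 : ℂ)] with t h1 h2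
  rw [h1, h2, fourier_zero]
  rfl

theorem fourierLp_smul (m n : ℤ) :
    (fourierLp (T := 2 * π) ∞ m • fourierLp (T := 2 * π) ∞ n : LInfty) = fourierLp ∞ (m + n) := by
  apply Lp.ext
  filter_upwards [coeFn_mul (fourierLp ∞ m) (fourierLp ∞ n), coeFn_fourierLp (T := 2 * π) ∞ m,
    coeFn_fourierLp (T := 2 * π) ∞ n, coeFn_fourierLp (T := 2 * π) ∞ (m + n)] with t h1 h2 h3 h4
  rw [h1, h2, h3, h4, fourier_add]

theorem star_idFn : star idFn = fourierLp (T := 2 * π) ∞ 1 := by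
  apply Lp.ext
  filter_upwards [Lp.coeFn_star idFn, coeFn_fourierLp (T := 2 * π) ∞ (-1),
    coeFn_fourierLp (T := 2 * π) ∞ 1] with t h1 h2 h3
  rw [h1, h3, Pi.star_apply, idFn, h2, fourier_neg]
  simp

/-- The sign comes from `T = π(z)` with `z = e^{-iθ}`, the Fourier monomial of index `-1`. -/
theorem T_zpow_apply (k : ℤ) (ξ : H) : (W.T ^ k) ξ = W.rep (fourierLp ∞ (-k)) ξ := by
  induction k using Int.induction_on with
  | zero => rw [neg_zero, fourierLp_zero_eq_const, W.rep_one]; rfl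
  | succ n ih =>
    rw [add_comm, zpow_add, zpow_one, neg_add, ← fourierLp_smul, W.rep_mul, ← ih]
    rfl
  | pred n ih =>
    have h : -(-(n : ℤ) - 1) = 1 + -(-(n : ℤ)) := by ring
    rw [sub_eq_neg_add, zpow_add, zpow_neg_one, ← sub_eq_neg_add, h, ← fourierLp_smul, W.rep_mul,
      ← ih, ← star_idFn]
    rfl

/-- The indicator function of a Borel set of the circle, as an element of `L^∞`. -/
def indicatorT {B : Set Torus} (hB : MeasurableSet B) : LInfty :=
  indicatorConstLp ∞ hB (measure_ne_top haarT B) (1 : ℂ)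

theorem coeFn_indicatorT {B : Set Torus} (hB : MeasurableSet B) :
    indicatorT hB =ᵐ[haarT] B.indicator fun _ => 1 :=
  indicatorConstLp_coeFn

theorem coeFn_compPow_iterate (f : LInfty) (j : ℕ) :
    (compPow N)^[j] f =ᵐ[haarT] fun t => f (N ^ j • t) := by
  induction j generalizing f with
  | zero => simp
  | succ j ih =>
    rw [Function.iterate_succ_apply']
    filter_upwards [coeFn_compPow N ((compPow N)^[j] f), (quasi_nsmul N).ae (ih f)] with t h1 h2
    rw [h1, h2, smul_smul, pow_succ]

theorem U_iterate_rep (f : LInfty) (j : ℕ) (ξ : H) :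
    W.U^[j] (W.rep f ξ) = W.rep ((compPow N)^[j] f) (W.U^[j] ξ) := by
  induction j with
  | zero => rfl
  | succ j ih =>
    rw [Function.iterate_succ_apply', Function.iterate_succ_apply', Function.iterate_succ_apply',
      ih, ← W.covariance, LinearIsometryEquiv.symm_apply_apply]

/-- If `m₀` equals the constant `c` along the first `J` steps of the orbit of almost every point
of `B`, then the iterates of the scaling equation reduce to multiplication by `c` over `B`. -/
theorem rep_indicatorT_U_iterate {m₀ : LInfty} {φ : H} (hφ : W.U φ = W.rep m₀ φ) {c : ℂ}
    {B : Set Torus} (hB : MeasurableSet B) (J : ℕ)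
    (hm : ∀ j < J, ∀ᵐ t ∂haarT, t ∈ B → m₀ (N ^ j • t) = c) :
    W.rep (indicatorT hB) (W.U^[J] φ) = c ^ J • W.rep (indicatorT hB) φ := by
  induction J with
  | zero => simp
  | succ J ih =>
    have h : (indicatorT hB • (compPow N)^[J] m₀ : LInfty) = c • indicatorT hB := by
      apply Lp.ext
      filter_upwards [coeFn_mul (indicatorT hB) ((compPow N)^[J] m₀), coeFn_indicatorT hB,
        coeFn_compPow_iterate (N := N) m₀ J, Lp.coeFn_smul c (indicatorT hB),
        hm J J.lt_succ_self] with t h1 h2 h3 h4 h5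
      rw [h1, h4, Pi.smul_apply, h2, h3]
      by_cases ht : t ∈ B
      · simp [ht, h5 ht]
      · simp [ht]
    rw [Function.iterate_succ_apply, hφ, U_iterate_rep, ← W.rep_mul, h, map_smul,
      smul_apply, ih fun j hj => hm j (hj.trans J.lt_succ_self), smul_smul,
      pow_succ']

end WaveletRep

/-! ### Spectral measures -/

section Spectral

variable {N n : ℕ} (C : Fin n → CircleCycle N)

/-- The Hilbert space of `ℜ_{C_1} ⊕ ⋯ ⊕ ℜ_{C_n}`. -/
abbrev CycleSpace : Type := PiLp 2 fun i : Fin n => PiLp 2 fun _ : Fin (C i).length => L2R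

variable {C}

/-- The Borel measure `B ↦ ⟪ξ, π(χ_B) ξ⟫` on the circle of a vector `ξ` of the sum of the `ℜ_{C_i}`:
the component of `ξ` at the point `z` of the cycles contributes the squared modulus of its Fourier
transform, wrapped around the circle and translated by `z`. -/
def spectralMeasure (ξ : CycleSpace C) : Measure Torus :=
  ∑ i, ∑ k, (volume.withDensity fun x => ‖fourierL2 (ξ i k) x‖ₑ ^ 2).map
    fun x => (C i).pt k + wrap x

theorem measurable_enorm_sq (F : L2R) : Measurable fun x => ‖F x‖ₑ ^ 2 :=
  (Lp.stronglyMeasurable F).measurable.enorm.pow_const 2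

theorem measurable_add_wrap (θ : Torus) : Measurable fun x => θ + wrap x :=
  measurable_wrap.const_add θ

instance isFiniteMeasure_enorm_sq (F : L2R) :
    IsFiniteMeasure ((volume : Measure ℝ).withDensity fun x => ‖F x‖ₑ ^ 2) :=
  isFiniteMeasure_withDensity (by rw [← enorm_sq_eq_lintegral]; simp)

instance (ξ : CycleSpace C) : IsFiniteMeasure (spectralMeasure ξ) := by
  unfold spectralMeasure
  infer_instance

theorem ae_add_wrap {p : Torus → Prop} (θ : Torus) (h : ∀ᵐ t ∂haarT, p t) :
    ∀ᵐ x : ℝ, p (θ + wrap x) :=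
  quasi_wrap.ae ((quasi_add θ).ae h)

theorem spectralMeasure_apply (ξ : CycleSpace C) {B : Set Torus} (hB : MeasurableSet B) :
    spectralMeasure ξ B
      = ∑ i, ∑ k, ∫⁻ x in {x | (C i).pt k + wrap x ∈ B}, ‖fourierL2 (ξ i k) x‖ₑ ^ 2 := by
  simp only [spectralMeasure, Measure.finsetSum_apply]
  refine Finset.sum_congr rfl fun i _ => Finset.sum_congr rfl fun k _ => ?_
  rw [Measure.map_apply (measurable_add_wrap _) hB,
    withDensity_apply _ (measurable_add_wrap _ hB)]
  rfl

variable [N.AtLeastTwo]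

theorem coeFn_fourier_rep (f : LInfty) (ξ : CycleSpace C) (i : Fin n) (k : Fin (C i).length) :
    fourierL2 ((cycleRep C).rep f ξ i k)
      =ᵐ[volume] fun x => f ((C i).pt k + wrap x) * fourierL2 (ξ i k) x := by
  have h : fourierL2 ((cycleRep C).rep f ξ i k)
      = multiplier (rotate ((C i).pt k) f) (fourierL2 (ξ i k)) :=
    LinearIsometryEquiv.apply_symm_apply _ _
  rw [h]
  filter_upwards [coeFn_multiplier (rotate ((C i).pt k) f) (fourierL2 (ξ i k)),
    quasi_wrap.ae (coeFn_rotate ((C i).pt k) f)] with x h1 h2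
  rw [h1, h2]

/-- As `π(χ_B)` is a projection, the spectral measure of `B` is `‖π(χ_B) ξ‖²`. -/
theorem enorm_rep_indicatorT_sq (ξ : CycleSpace C) {B : Set Torus} (hB : MeasurableSet B) :
    ‖(cycleRep C).rep (indicatorT hB) ξ‖ₑ ^ 2 = spectralMeasure ξ B := by
  rw [spectralMeasure_apply ξ hB, PiLp_enorm_sq]
  refine Finset.sum_congr rfl fun i _ => ?_
  rw [PiLp_enorm_sq]
  refine Finset.sum_congr rfl fun k _ => ?_
  rw [← LinearIsometryEquiv.enorm_map fourierL2, enorm_sq_eq_lintegral]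
  refine Eq.trans ?_ (lintegral_indicator (measurable_add_wrap ((C i).pt k) hB) _)
  refine lintegral_congr_ae ?_
  filter_upwards [coeFn_fourier_rep (indicatorT hB) ξ i k,
    ae_add_wrap ((C i).pt k) (coeFn_indicatorT hB)] with x h1 h2
  rw [h1, h2]
  by_cases hx : (C i).pt k + wrap x ∈ B <;> simp [hx, indicator]

/-- The spectral measure of `ξ` represents `f ↦ ⟪ξ, π(f) ξ⟫`. Continuity of a representative `g` of
`f` makes the integral of `g` against a measure other than the Haar measure meaningful. -/
theorem inner_rep_eq_integral (ξ : CycleSpace C) (f : LInfty) (g : C(Torus, ℂ))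
    (hfg : f =ᵐ[haarT] g) :
    inner ℂ ξ ((cycleRep C).rep f ξ) = ∫ t, g t ∂spectralMeasure ξ := by
  have hint : ∀ (ρ : Measure Torus) [IsFiniteMeasure ρ], Integrable g ρ := fun ρ _ =>
    g.continuous.integrable_of_hasCompactSupport (HasCompactSupport.of_compactSpace _)
  rw [spectralMeasure, integral_finsetSum_measure fun i _ => hint _, PiLp.inner_apply]
  refine Finset.sum_congr rfl fun i _ => ?_
  rw [integral_finsetSum_measure fun k _ => hint _, PiLp.inner_apply]
  refine Finset.sum_congr rfl fun k _ => ?_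
  rw [integral_map (measurable_add_wrap _).aemeasurable g.continuous.aestronglyMeasurable,
    ← fourierL2.inner_map_map, L2.inner_def]
  have h := integral_withDensity_eq_integral_smul (μ := volume)
    (f := fun x => ‖fourierL2 (ξ i k) x‖₊ ^ 2)
    ((Lp.stronglyMeasurable _).measurable.nnnorm.pow_const 2)
    (fun x => g ((C i).pt k + wrap x))
  simp only [ENNReal.coe_pow] at h
  refine Eq.trans ?_ h.symm
  refine integral_congr_ae ?_
  filter_upwards [coeFn_fourier_rep f ξ i k, ae_add_wrap ((C i).pt k) hfg] with x h1 h2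
  rw [h1, h2, RCLike.inner_apply, NNReal.smul_def, mul_assoc, RCLike.mul_conj, Complex.real_smul]
  push_cast
  exact mul_comm _ _

/-- If the integer translates of `φ` are orthonormal, its spectral measure is the Haar measure. -/
theorem spectralMeasure_eq_haarT {φ : CycleSpace C}
    (h : Orthonormal ℂ fun k : ℤ => ((cycleRep C).T ^ k) φ) : spectralMeasure φ = haarT := by
  refine measure_ext_of_integral_fourier fun m => ?_
  rw [← inner_rep_eq_integral φ (fourierLp ∞ m) (fourier m) (coeFn_fourierLp ∞ m)]
  have h1 := orthonormal_iff_ite.1 h 0 (-m)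
  rw [T_zpow_apply, T_zpow_apply, neg_neg, neg_zero, fourierLp_zero_eq_const,
    (cycleRep C).rep_one] at h1
  have h2 := orthonormal_iff_ite.1 (orthonormal_fourier (T := 2 * π)) 0 m
  rw [h1]
  rw [fourierLp, fourierLp, ContinuousMap.inner_toLp] at h2
  simp only [fourier_zero, map_one, mul_one] at h2
  rw [h2]
  simp [eq_comm]

end Spectral

/-! ### Decay of Fourier tails under dilation -/

section Tail

variable {N n : ℕ} {C : Fin n → CircleCycle N}

/-- The energy of the Fourier transforms of the components of `ξ` on `{x : ρ ≤ |x|}`. -/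
def fourierTail (ρ : ℝ) (ξ : CycleSpace C) : ℝ≥0∞ :=
  ∑ i, ∑ k, ∫⁻ x in {x | ρ ≤ |x|}, ‖fourierL2 (ξ i k) x‖ₑ ^ 2

theorem measurableSet_le_abs (ρ : ℝ) : MeasurableSet {x : ℝ | ρ ≤ |x|} :=
  measurableSet_le measurable_const continuous_abs.measurable

/-- The inverse dilation contracts functions, so it moves the threshold `c ρ` down to `ρ`. -/
theorem lintegral_dilate_symm {c : ℝ} (hc : 0 < c) (G : L2R) (ρ : ℝ) :
    ∫⁻ x in {x | ρ ≤ |x|}, ‖(dilate c hc).symm G x‖ₑ ^ 2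
      = ∫⁻ x in {x | c * ρ ≤ |x|}, ‖G x‖ₑ ^ 2 := by
  rw [← lintegral_indicator (measurableSet_le_abs _), ← lintegral_indicator (measurableSet_le_abs _)]
  have hvol : ∀ g : ℝ → ℝ≥0∞,
      ∫⁻ x, g x = ∫⁻ x, g x ∂(ENNReal.ofReal |c| • Measure.map (c * ·) volume) := fun g => by
    rw [Real.smul_map_volume_mul_left hc.ne']
  rw [hvol ({x | c * ρ ≤ |x|}.indicator _), lintegral_smul_measure, lintegral_map
    ((measurable_enorm_sq G).indicator (measurableSet_le_abs _)) (measurable_const_mul c),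
    smul_eq_mul, ← lintegral_const_mul' _ _ ENNReal.ofReal_ne_top]
  refine lintegral_congr_ae ?_
  filter_upwards [coeFn_dilate_symm hc G] with x hx
  have hs : ‖(√c : ℂ)‖ₑ ^ 2 = ENNReal.ofReal |c| := by
    rw [← ofReal_norm, Complex.norm_real, Real.norm_of_nonneg (Real.sqrt_nonneg c),
      ← ENNReal.ofReal_pow (Real.sqrt_nonneg c), Real.sq_sqrt hc.le, abs_of_pos hc]
  have hmem : c * ρ ≤ |c * x| ↔ ρ ≤ |x| := by
    rw [abs_mul, abs_of_pos hc, mul_le_mul_iff_right₀ hc]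
  by_cases h : ρ ≤ |x|
  · rw [indicator_of_mem (by exact h), indicator_of_mem (by exact hmem.2 h), hx, enorm_mul,
      mul_pow, hs]
  · rw [indicator_of_notMem (by exact h), indicator_of_notMem (by exact fun h' => h (hmem.1 h')),
      mul_zero]

theorem tendsto_fourierTail (ξ : CycleSpace C) :
    Tendsto (fun ρ => fourierTail ρ ξ) atTop (𝓝 0) := by
  have h0 : (0 : ℝ≥0∞) = ∑ i : Fin n, ∑ _k : Fin (C i).length, 0 := by simp
  rw [h0]
  refine tendsto_finsetSum _ fun i _ => tendsto_finsetSum _ fun k _ => ?_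
  have h := tendsto_measure_iInter_atTop
    (μ := volume.withDensity fun x => ‖fourierL2 (ξ i k) x‖ₑ ^ 2) (s := fun ρ : ℝ => {x | ρ ≤ |x|})
    (fun ρ => (measurableSet_le_abs ρ).nullMeasurableSet)
    (fun ρ σ hρσ x hx => le_trans hρσ hx) ⟨0, measure_ne_top _ _⟩
  have he : ⋂ ρ : ℝ, {x : ℝ | ρ ≤ |x|} = ∅ :=
    eq_empty_of_forall_notMem fun x hx => by
      have := mem_iInter.1 hx (|x| + 1)
      simp only [mem_ofPred_eq] at this
      linarith
  rw [he, measure_empty] at h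
  refine h.congr fun ρ => ?_
  exact withDensity_apply _ (measurableSet_le_abs ρ)

/-- On a set that the points `z` of the cycles reach only after moving by at least `ρ`, the spectral
measure sees nothing but the Fourier tails. -/
theorem spectralMeasure_le_fourierTail (ξ : CycleSpace C) {B : Set Torus} (hB : MeasurableSet B)
    {ρ : ℝ} (h : ∀ i k x, (C i).pt k + wrap x ∈ B → ρ ≤ |x|) :
    spectralMeasure ξ B ≤ fourierTail ρ ξ := by
  rw [spectralMeasure_apply ξ hB]
  exact Finset.sum_le_sum fun i _ => Finset.sum_le_sum fun k _ =>
    lintegral_mono_set fun x hx => h i k x hx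

variable [N.AtLeastTwo]

/-- `U` permutes the components along each cycle and contracts their Fourier transforms by the
factor `N`. -/
theorem fourierTail_U (ρ : ℝ) (ξ : CycleSpace C) :
    fourierTail ρ ((cycleRep C).U ξ) = fourierTail (N * ρ) ξ := by
  refine Finset.sum_congr rfl fun i _ => ?_
  rw [← Equiv.sum_comp (finRotate (C i).length)
    fun k => ∫⁻ x in {x | N * ρ ≤ |x|}, ‖fourierL2 (ξ i k) x‖ₑ ^ 2]
  refine Finset.sum_congr rfl fun k _ => ?_
  have h1 : (cycleRep C).U ξ i k
      = dilate N (natCast_pos' N) (ξ i (finRotate (C i).length k)) :=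
    cyclicDilation_apply _ _ (ξ i) k
  have h2 : fourierL2 ((cycleRep C).U ξ i k) = (dilate N (natCast_pos' N)).symm
      (fourierL2 (ξ i (finRotate (C i).length k))) := by
    rw [h1]; exact fourier_dilate _ _
  rw [h2, lintegral_dilate_symm]

theorem fourierTail_U_iterate (ρ : ℝ) (ξ : CycleSpace C) (J : ℕ) :
    fourierTail ρ ((cycleRep C).U^[J] ξ) = fourierTail (N ^ J * ρ) ξ := by
  induction J generalizing ρ with
  | zero => simp
  | succ J ih =>
    rw [Function.iterate_succ_apply', fourierTail_U, ih, pow_succ, mul_assoc]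

end Tail

/-! ### Cycles -/

section Cycles

variable {N : ℕ}

theorem CircleCycle.pow_nsmul_mem (D : CircleCycle N) {v : Torus} (hv : v ∈ D.points) (j : ℕ) :
    N ^ j • v ∈ D.points := by
  induction j with
  | zero => simpa using hv
  | succ j ih =>
    obtain ⟨k, hk⟩ := ih
    exact ⟨finRotate D.length k, by rw [← D.next, hk, smul_smul, pow_succ']⟩

theorem pow_nsmul_mem_closedBall (hN : 0 < N) {v t : Torus} {r : ℝ} {j J : ℕ}
    (hj : j ≤ J) (ht : t ∈ Metric.closedBall v (r / N ^ J)) :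
    N ^ j • t ∈ Metric.closedBall (N ^ j • v) r := by
  rw [mem_closedBall_iff_norm] at *
  have hN' : (1 : ℝ) ≤ N := by exact_mod_cast hN
  calc ‖N ^ j • t - N ^ j • v‖ = ‖N ^ j • (t - v)‖ := by rw [nsmul_sub]
    _ ≤ (N ^ j : ℕ) * ‖t - v‖ := norm_nsmul_le
    _ ≤ N ^ J * (r / N ^ J) := by
        push_cast
        gcongr
    _ = r := by field_simp

/-- Cycles disjoint from finitely many given cycles stay at a positive distance from them. -/
theorem exists_forall_le_dist {n : ℕ} (C : Fin n → CircleCycle N) {v : Torus}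
    (hv : ∀ i, v ∉ (C i).points) : ∃ d > 0, ∀ i k, d ≤ dist ((C i).pt k) v := by
  have h : ∀ᶠ d in 𝓝[>] (0 : ℝ), ∀ i k, d ≤ dist ((C i).pt k) v := by
    refine eventually_all.2 fun i => eventually_all.2 fun k => ?_
    have hpos : 0 < dist ((C i).pt k) v := dist_pos.2 fun h => hv i ⟨k, h⟩
    exact nhdsWithin_le_nhds (eventually_le_nhds hpos)
  obtain ⟨d, hd, h0⟩ := (h.and self_mem_nhdsWithin).exists
  exact ⟨d, h0, hd⟩

/-- If the angles of `D` lie in `E`, then they are interior points of the intervals that make up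
`E`, so `m₀` is almost everywhere the constant `√N` near the points of `D`. -/
theorem exists_forall_ae_eq_sqrt {ι : Type*} {I : ι → Set ℝ} {a b : ι → ℝ}
    (hI : ∀ i, IsIntervalWithEndpoints (I i) (a i) (b i)) {E : Set ℝ} (hE : E = ⋃ i, I i)
    (hEsub : E ⊆ Icc (-π) π) (D : CircleCycle N)
    (hend : ∀ i, ((a i : ℝ) : Torus) ∉ D.points ∧ ((b i : ℝ) : Torus) ∉ D.points) (m₀ : LInfty)
    (hm₀ : ∀ᵐ θ ∂(volume.restrict (Icc (-π) π)),
      m₀ ((θ : ℝ) : Torus) = (√(N : ℝ) : ℂ) * E.indicator (fun _ => (1 : ℂ)) θ)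
    (hD : ∀ θ ∈ Icc (-π) π, ((θ : ℝ) : Torus) ∈ D.points → θ ∈ E) :
    ∃ r > 0, ∀ v ∈ D.points, ∀ᵐ t ∂haarT, t ∈ Metric.closedBall v r → m₀ t = (√(N : ℝ) : ℂ) := by
  have key : ∀ k : Fin D.length, ∀ᶠ r in 𝓝[>] (0 : ℝ),
      ∀ᵐ t ∂haarT, t ∈ Metric.closedBall (D.pt k) r → m₀ t = (√(N : ℝ) : ℂ) := by
    intro k
    have hT : -π + 2 * π = π := by ring
    obtain ⟨θ, hθ, hθk⟩ : ∃ θ ∈ Ioc (-π) π, ((θ : ℝ) : Torus) = D.pt k :=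
      ⟨AddCircle.equivIoc (2 * π) (-π) (D.pt k),
        by simpa only [hT] using (AddCircle.equivIoc (2 * π) (-π) (D.pt k)).2,
        AddCircle.coe_equivIoc⟩
    have hθD : ((θ : ℝ) : Torus) ∈ D.points := ⟨k, hθk.symm⟩
    have hθE := hD θ (Ioc_subset_Icc_self hθ) hθD
    rw [hE] at hθE
    obtain ⟨i, hi⟩ := mem_iUnion.1 hθE
    obtain ⟨-, hIoo, hIcc⟩ := hI i
    have hθi : θ ∈ Ioo (a i) (b i) :=
      ⟨lt_of_le_of_ne (hIcc hi).1 fun h => (hend i).1 (by rwa [h]),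
        lt_of_le_of_ne (hIcc hi).2 fun h => (hend i).2 (by rwa [← h])⟩
    have hsubE : Ioo (a i) (b i) ⊆ E := by
      rw [hE]; exact hIoo.trans (subset_iUnion I i)
    -- This excludes `θ = π`: the circle near that point is not covered by angles just below `π`.
    have hsub : Ioo (a i) (b i) ⊆ Ioo (-π) π := by
      have h := interior_mono (hsubE.trans hEsub)
      rwa [isOpen_Ioo.interior_eq, interior_Icc] at h
    have hnhds : (fun x : ℝ => (x : Torus)) '' Ioo (a i) (b i) ∈ 𝓝 (D.pt k) :=
      (QuotientAddGroup.isOpenMap_coe _ isOpen_Ioo).mem_nhds ⟨θ, hθi, hθk⟩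
    obtain ⟨ε, hε, hball⟩ := Metric.nhds_basis_closedBall.mem_iff.1 hnhds
    have hrε : ∀ᶠ r in 𝓝[>] (0 : ℝ), r ≤ ε := nhdsWithin_le_nhds (eventually_le_nhds hε)
    filter_upwards [hrε] with r hr
    have hmeas : MeasurableSet
        {t : Torus | t ∈ Metric.closedBall (D.pt k) r → m₀ t = (√(N : ℝ) : ℂ)} := by
      have h1 : MeasurableSet {t : Torus | m₀ t = (√(N : ℝ) : ℂ)} :=
        (Lp.stronglyMeasurable m₀).measurable (measurableSet_singleton _)
      have h2 : MeasurableSet (Metric.closedBall (D.pt k) r) := measurableSet_closedBall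
      exact h2.imp h1
    have hvol : ∀ᵐ t ∂(volume : Measure Torus),
        t ∈ Metric.closedBall (D.pt k) r → m₀ t = (√(N : ℝ) : ℂ) := by
      have hmp := AddCircle.measurePreserving_mk (2 * π) (-π)
      rw [← hmp.map_eq, ae_map_iff hmp.measurable.aemeasurable hmeas, hT]
      have hm' := ae_mono (Measure.restrict_mono Ioc_subset_Icc_self le_rfl) hm₀
      filter_upwards [hm', ae_restrict_mem measurableSet_Ioc] with x hx hxI hxb
      obtain ⟨y, hy, hyx⟩ := hball (Metric.closedBall_subset_closedBall hr hxb)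
      have hxy : y = x := by
        refine (AddCircle.coe_eq_coe_iff_of_mem_Ioc (a := -π) ?_ ?_).1 hyx <;> rw [hT]
        · exact Ioo_subset_Ioc_self (hsub hy)
        · exact hxI
      have hxE : x ∈ E := hsubE (hxy ▸ hy)
      rw [indicator_of_mem hxE, mul_one] at hx
      exact hx
    rw [AddCircle.volume_eq_smul_haarAddCircle] at hvol
    exact (Measure.ae_ennreal_smul_measure_iff (by simpa using Real.pi_pos)).1 hvol
  obtain ⟨r, hr, h0⟩ := ((eventually_all.2 key).and self_mem_nhdsWithin).exists
  exact ⟨r, h0, by rintro _ ⟨k, rfl⟩; exact hr k⟩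

end Cycles

end SuperWavelet

end

open SuperWavelet

theorem proposition5p3 (N : ℕ) [N.AtLeastTwo]
    {ι : Type*} (I : ι → Set ℝ) (a b : ι → ℝ)
    (hI : ∀ i, IsIntervalWithEndpoints (I i) (a i) (b i))
    (E : Set ℝ) (hE : E = ⋃ i, I i) (hEsub : E ⊆ Icc (-π) π)
    (hend : ∀ (i : ι) (D : CircleCycle N),
      ((a i : ℝ) : Torus) ∉ D.points ∧ ((b i : ℝ) : Torus) ∉ D.points)
    (m₀ : LInfty)
    (hm₀ : ∀ᵐ θ ∂(volume.restrict (Icc (-π) π)),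
      m₀ ((θ : ℝ) : Torus) = (√(N : ℝ) : ℂ) * E.indicator (fun _ => (1 : ℂ)) θ)
    {n : ℕ} (C : Fin n → CircleCycle N)
    (hC : Function.Injective fun i => (C i).points)
    (hφ : ∃ φ, (cycleRep C).IsOrthogonalScalingVectorWithFilter m₀ φ)
    (D : CircleCycle N) (hD : ∀ i, Disjoint D.points (C i).points) :
    ∃ θ ∈ Icc (-π) π \ E, ((θ : ℝ) : Torus) ∈ D.points := by
  by_contra! hcon
  obtain ⟨φ, ⟨V, hV⟩, hscale⟩ := hφ
  obtain ⟨r₀, hr₀, hm⟩ := exists_forall_ae_eq_sqrt hI hE hEsub D (fun i => hend i D) m₀ hm₀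
    fun θ hθ hθD => by
      by_contra hθE
      exact hcon θ ⟨hθ, hθE⟩ hθD
  let w : Torus := D.pt ⟨0, D.length_pos⟩
  have hw : w ∈ D.points := mem_range_self _
  obtain ⟨d, hd, hdist⟩ := exists_forall_le_dist C fun i => disjoint_left.1 (hD i) hw
  -- `r ≤ r₀` controls `m₀` along the orbit of `w`, `r ≤ d / 2` keeps the balls away from the cycles
  -- `C i`, and `r ≤ π` is the range in which arcs of radius `r` have Haar measure `r / π`.
  let r : ℝ := min (min r₀ (d / 2)) π
  have hr : 0 < r := by
    have := Real.pi_pos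
    positivity
  have hrr₀ : r ≤ r₀ := (min_le_left _ _).trans (min_le_left _ _)
  have hrd : r ≤ d / 2 := (min_le_left _ _).trans (min_le_right _ _)
  have hrπ : r ≤ π := min_le_right _ _
  have hN : 0 < N := NeZero.pos N
  have hN1 : (1 : ℝ) ≤ N := by exact_mod_cast hN
  have hNpow : ∀ J : ℕ, r / (N : ℝ) ^ J ≤ r := fun J => div_le_self hr.le (one_le_pow₀ hN1)
  have hB : ∀ J : ℕ, MeasurableSet (Metric.closedBall w (r / (N : ℝ) ^ J)) := fun J =>
    measurableSet_closedBall
  have hρ : 0 < d / (4 * π) := by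
    have := Real.pi_pos
    positivity
  have hbound : ∀ J : ℕ, ENNReal.ofReal (r / π) ≤ fourierTail ((N : ℝ) ^ J * (d / (4 * π))) φ := by
    intro J
    have hrep := rep_indicatorT_U_iterate (cycleRep C) hscale (c := (√(N : ℝ) : ℂ)) (hB J) J
      fun j hj => by
        filter_upwards [((measurePreserving_nsmul (N ^ j)).quasiMeasurePreserving).ae
          (hm _ (D.pow_nsmul_mem hw j))] with t ht htB
        exact ht (Metric.closedBall_subset_closedBall hrr₀
          (pow_nsmul_mem_closedBall hN hj.le htB))
    -- The factor `N ^ J` from the scaling equation compensates the shrinking of the ball.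
    have hmass : spectralMeasure ((cycleRep C).U^[J] φ) (Metric.closedBall w (r / (N : ℝ) ^ J))
        = ENNReal.ofReal (r / π) := by
      have hs : ‖(√(N : ℝ) : ℂ)‖ₑ ^ 2 = ENNReal.ofReal N := by
        rw [← ofReal_norm, Complex.norm_real, Real.norm_of_nonneg (Real.sqrt_nonneg _),
          ← ENNReal.ofReal_pow (Real.sqrt_nonneg _), Real.sq_sqrt (Nat.cast_nonneg N)]
      rw [← enorm_rep_indicatorT_sq _ (hB J), hrep, enorm_smul, mul_pow, enorm_rep_indicatorT_sq,
        spectralMeasure_eq_haarT hV.orthonormal, haarT_closedBall w ((hNpow J).trans hrπ),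
        enorm_pow, ← pow_mul, mul_comm J, pow_mul, hs, ← ENNReal.ofReal_pow (Nat.cast_nonneg N),
        ← ENNReal.ofReal_mul (by positivity)]
      congr 1
      field_simp
    rw [← hmass, ← fourierTail_U_iterate]
    refine spectralMeasure_le_fourierTail _ (hB J) fun i k x hx => ?_
    have h1 : dist ((C i).pt k + wrap x) w ≤ d / 2 :=
      (Metric.mem_closedBall.1 hx).trans ((hNpow J).trans hrd)
    have h2 : dist ((C i).pt k) ((C i).pt k + wrap x) ≤ 2 * π * |x| := by
      rw [dist_self_add_right]; exact norm_wrap_le x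
    have h3 := (hdist i k).trans (dist_triangle _ ((C i).pt k + wrap x) w)
    rw [div_le_iff₀ (by positivity)]
    linarith
  have hlim : Filter.Tendsto (fun J : ℕ => fourierTail ((N : ℝ) ^ J * (d / (4 * π))) φ)
      Filter.atTop (nhds 0) :=
    (tendsto_fourierTail φ).comp ((tendsto_pow_atTop_atTop_of_one_lt (by
      exact_mod_cast Nat.AtLeastTwo.one_lt)).atTop_mul_const hρ)
  have hle := ge_of_tendsto' hlim hbound
  have hpos : 0 < ENNReal.ofReal (r / π) := ENNReal.ofReal_pos.2 (by positivity)
  exact absurd hle (not_le.2 hpos)
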